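/- Let $\alpha<\beta$ be real numbers and let $S>0$. There exist constants $0<\lambda<1$, $0<c_0<1$ and $c_1>0$, depending only on $\alpha,\beta,S$, such that the following holds. Let $G$ be a countable group and let $(F_n)$ be a left Følner sequence in $G$, i.e. a sequence of nonempty finite subsets of $G$ with $|gF_n\,\triangle\,F_n|/|F_n|\to 0$ for every $g\in G$. Assume that $(F_n)$ is $\lambda$-good, that is, (i) $\left|\left(\bigcup_{i<n}F_i^{-1}F_n\right)\setminus F_n\right|\le\lambda|F_n|$ for every $n$, and (ii) $|F_n\setminus F_nh|<\lambda|F_n|$ for all $i<n$ and all $h\in F_i$. Let $(X,\mathscr B,\mu)$ be a probability space on which $G$ acts by measurable, measure-preserving transformations $(T_g)_{g\in G}$, with $T_gT_h=T_{gh}$, and let $f\in L^\infty(\mu)$ be real valued with $\|f\|_\infty\le S$. Put $\mathsf A_nf(x)=\frac1{|F_n|}\sum_{g\in F_n}f(T_gx)$. For $N\in\{0,1,2,\dots\}$ let $D_N$ be the set of all $x\in X$ for which there are indices $n_1<n_2<\dots<n_{2N}$ with $\mathsf A_{n_i}f(x)\le\alpha$ for every odd $i$ and $\mathsf A_{n_i}f(x)\ge\beta$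 for every even $i$. Then $$\mu(D_N)\le c_1c_0^N\qquad\text{for all } N.$$ -/

import Mathlib

namespace FolnerFluct

open MeasureTheory Filter
open scoped Pointwise

/-- The real sequence `a` fluctuates (at least) `N` times across the gap `(α, β)`: there are
indices `n 1 < n 2 < ⋯ < n (2 * N)` with `a (n i) ≤ α` for odd `i` and `a (n i) ≥ β` for
even `i`. -/
def Fluctuates (a : ℕ → ℝ) (α β : ℝ) (N : ℕ) : Prop :=
  ∃ n : ℕ → ℕ, StrictMonoOn n (Set.Icc 1 (2 * N)) ∧
    ∀ i ∈ Set.Icc 1 (2 * N),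
      (Odd i → a (n i) ≤ α) ∧ (Even i → β ≤ a (n i))

/-- `F` is a left Følner sequence of nonempty finite subsets of the discrete group `G`:
`|gF_n ∆ F_n| / |F_n| → 0` for every `g`. This is Mathlib's notion for the action of `G` on itself
by left multiplication and the counting measure on the σ-algebra of all subsets. -/
def IsLeftFolner {G : Type*} [Group G] (F : ℕ → Finset G) : Prop :=
  (∀ n, (F n).Nonempty) ∧
    @IsFoelner G G ⊤ (@Measure.count G ⊤) _ _ ℕ atTop (fun n => (F n : Set G))

open scoped Classical in
/-- `F` is `l`-good:
* `|(⋃_{i<n} F_i⁻¹ F_n) \ F_n| ≤ l |F_n|` for all `n`;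
* `|F_n \ F_n h| < l |F_n|` for all `i < n` and `h ∈ F_i`. -/
def IsGood {G : Type*} [Group G] (l : ℝ) (F : ℕ → Finset G) : Prop :=
  (∀ n, ((((Finset.range n).biUnion fun i => (F i)⁻¹ * F n) \ F n).card : ℝ)
      ≤ l * ((F n).card : ℝ)) ∧
  (∀ i n, i < n → ∀ h ∈ F i,
    ((F n \ (F n * {h})).card : ℝ) < l * ((F n).card : ℝ))

/-- The average `A_n f (x) = |F_n|⁻¹ ∑_{g ∈ F_n} f (g x)`. -/
noncomputable def avg {G X : Type*} [Group G] [MulAction G X] (F : ℕ → Finset G) (f : X → ℝ)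
    (n : ℕ) (x : X) : ℝ :=
  (∑ g ∈ F n, f (g • x)) / ((F n).card : ℝ)

/-- The set `D_N` of points at which the averages of `f` along `F` fluctuate at least `N` times
across the gap `(α, β)`. -/
def fluctSet {G X : Type*} [Group G] [MulAction G X] (F : ℕ → Finset G) (f : X → ℝ)
    (α β : ℝ) (N : ℕ) : Set X :=
  {x | Fluctuates (fun n => avg F f n x) α β N}

end FolnerFluct

/-!
Fix a point `x` and put `φ g = f (g • x)`, so that `avg F f n (g • x)` is the mean of `φ` over the
right translate ("tile") `F n * g`. By transference it suffices to bound, for a finite set `K`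
that is almost invariant, the number of elements of the set `D` of all `g ∈ K` for which `g • x`
fluctuates `N` times; every `a ∈ D` then comes with increasing levels `n a 1 < n a 2 < ⋯` whose
tiles have averages alternately at most `α` and at least `β`. The levels are cut into blocks of
length `2 * r`, where `r` depends only on `α`, `β` and the bound `S` on `f`, and each block keeps
one of the two parities, in alternation.

The proof constructs, block after block, weighted families of tiles based at the points of `D`
that are almost fractional packings (`NearPacking`), and shows that their masses grow by a factor
`1 + c` at each step (`NearPacking.exists_growth`). As the mass of a packing is at most the number
of points available, which is at most `2 * |K|`, it follows that `|D|` is exponentially small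
relative to `|K|`.

The growth rests on a covering lemma (`exists_packing`). Let `V` be the current multiplicity,
truncated at one. Each point of a current tile based at `a` is offered tiles of the `r` levels of
the next block of `a`, and the offers are accepted greedily, largest levels first, as far as there
is room. Condition (i) says that a smaller tile which does not fit because of a larger one mostly
has its centre inside the larger one. Hence the resulting packing `U`, of mass `M'`, satisfies
`r * ∑ V * (1 - U) ≤ (1 + r * l) * M'`: either the mass has grown, or almost all of `V` is
covered by `U`. In the second case, if `M'` were less than `(1 + c) * M`, with `M` the mass of the current
family, then `U` and `V` would be close in `ℓ¹`; this is impossible, since `φ` is bounded, has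
average at most `α` with respect to one of them and at least `β` with respect to the other, up to
errors proportional to `l`.

Condition (ii) allows each new tile `F m * y`, where `y ∈ F n * a` and `n < m`, to be moved back
to `F m * a` at a cost proportional to `l`. Thus the tiles of every block are based at the points
of `D` itself, with exact bounds on their averages, and errors do not accumulate over the blocks:
they are always relative to the current mass.
-/

namespace FolnerFluct

open scoped Pointwise

/-! ### Weighted families of tiles -/

open scoped Classical in
/-- The multiplicity with which `z` is covered by the weighted tiles `F n * y i`, where `i ∈ s`,
`n ∈ Λ i`, and the tile `F n * y i` carries the weight `W i n`. Membership of `z` in the right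
translate `F n * y i` is encoded as `z * (y i)⁻¹ ∈ F n`. -/
noncomputable def cover {G ι : Type*} [Group G] (F : ℕ → Finset G) (s : Finset ι) (y : ι → G)
    (Λ : ι → Finset ℕ) (W : ι → ℕ → ℝ) (z : G) : ℝ :=
  ∑ i ∈ s, ∑ n ∈ Λ i, W i n * (if z * (y i)⁻¹ ∈ F n then 1 else 0)

/-- The total mass `∑ W i n |F n|` of a weighted family of tiles. -/
noncomputable def mass {G ι : Type*} (F : ℕ → Finset G) (s : Finset ι)
    (Λ : ι → Finset ℕ) (W : ι → ℕ → ℝ) : ℝ :=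
  ∑ i ∈ s, ∑ n ∈ Λ i, W i n * ((F n).card : ℝ)

open scoped Classical in
/-- The points `c` outside `F n` for which the smaller tile `F i * c` meets `F n`, for some
`i < n`; condition (i) of a good sequence bounds their number. -/
noncomputable def outerBoundary {G : Type*} [Group G] (F : ℕ → Finset G) (n : ℕ) : Finset G :=
  ((Finset.range n).biUnion fun i => (F i)⁻¹ * F n) \ F n

theorem mass_nonneg {G ι : Type*} {F : ℕ → Finset G} {s : Finset ι} {Λ : ι → Finset ℕ}
    {W : ι → ℕ → ℝ} (hW : ∀ i n, 0 ≤ W i n) : 0 ≤ mass F s Λ W :=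
  Finset.sum_nonneg fun i _ => Finset.sum_nonneg fun n _ => mul_nonneg (hW i n) (Nat.cast_nonneg _)

open scoped Classical in
/-- If the demands located at any single point add up to at most one, the total demand in a finite
set of points, given here as the injective image of `B`, is at most its cardinality. -/
theorem sum_demand_le {G ι : Type*} {s : Finset ι} {y : ι → G} {v : ι → ℝ}
    (hp : ∀ z, ∑ i ∈ s with y i = z, v i ≤ 1)
    {κ : Type*} (B : Finset κ) (p : κ → G) (hinj : Function.Injective p) :
    ∑ i ∈ s, v i * (if ∃ b ∈ B, y i = p b then 1 else 0) ≤ B.card := by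
  calc ∑ i ∈ s, v i * (if ∃ b ∈ B, y i = p b then 1 else 0)
      = ∑ b ∈ B, ∑ i ∈ s with y i = p b, v i := by
        simp_rw [Finset.sum_filter]
        rw [Finset.sum_comm]
        refine Finset.sum_congr rfl fun i _ => ?_
        split_ifs with h
        · obtain ⟨b, hb, hib⟩ := h
          rw [Finset.sum_eq_single b]
          · simp [hib]
          · intro c _ hc
            rw [if_neg]
            intro h'
            exact hc (hinj (h'.symm.trans hib))
          · intro h'; exact absurd hb h'
        · rw [mul_zero, eq_comm]
          refine Finset.sum_eq_zero fun b hb => if_neg fun h' => h ⟨b, hb, h'⟩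
    _ ≤ ∑ b ∈ B, 1 := Finset.sum_le_sum fun b _ => hp _
    _ = B.card := by simp

section
variable {G ι : Type*} [Group G] {F : ℕ → Finset G} {s : Finset ι} {y : ι → G}
  {Λ : ι → Finset ℕ} {W : ι → ℕ → ℝ}

theorem cover_nonneg (hW : ∀ i n, 0 ≤ W i n) (z : G) : 0 ≤ cover F s y Λ W z := by
  unfold cover
  refine Finset.sum_nonneg fun i _ => Finset.sum_nonneg fun n _ => ?_
  have := hW i n
  split_ifs <;> simp [this]

open scoped Classical in
theorem sum_translate {A Ω : Finset G} {c : G} (h : ∀ a ∈ A, a * c ∈ Ω) (g : G → ℝ) :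
    ∑ z ∈ Ω, (if z * c⁻¹ ∈ A then g z else 0) = ∑ a ∈ A, g (a * c) := by
  rw [← Finset.sum_filter]
  refine Finset.sum_nbij' (fun z => z * c⁻¹) (fun a => a * c) ?_ ?_ ?_ ?_ ?_ <;>
    simp +contextual [h]

open scoped Classical in
theorem sum_cover_mul {Ω : Finset G} (hΩ : ∀ i ∈ s, ∀ n ∈ Λ i, ∀ h ∈ F n, h * y i ∈ Ω)
    (g : G → ℝ) :
    ∑ z ∈ Ω, cover F s y Λ W z * g z
      = ∑ i ∈ s, ∑ n ∈ Λ i, W i n * ∑ h ∈ F n, g (h * y i) := by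
  unfold cover
  simp_rw [Finset.sum_mul]
  rw [Finset.sum_comm]
  refine Finset.sum_congr rfl fun i hi => ?_
  rw [Finset.sum_comm]
  refine Finset.sum_congr rfl fun n hn => ?_
  rw [← sum_translate (hΩ i hi n hn) g, Finset.mul_sum]
  refine Finset.sum_congr rfl fun z _ => ?_
  split_ifs <;> simp

theorem sum_cover {Ω : Finset G} (hΩ : ∀ i ∈ s, ∀ n ∈ Λ i, ∀ h ∈ F n, h * y i ∈ Ω) :
    ∑ z ∈ Ω, cover F s y Λ W z = mass F s Λ W := by
  simpa [mass] using sum_cover_mul (W := W) hΩ (fun _ => 1)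

/-! ### The covering lemma -/

open scoped Classical in
/-- The greedy construction, from the largest level `n < L` downwards, of a fractional packing by
tiles. At level `m` the item `i` asks for the mass `v i`, and receives the fraction of it
by which the tile `F m * y i` is still free at its most occupied point. The last clause bounds this
fraction below by what is seen at the centre `y i` alone. The parameter `k` counts the levels
already treated. -/
theorem exists_greedy_packing (hne : ∀ n, (F n).Nonempty) {v : ι → ℝ} (hv : ∀ i, 0 ≤ v i)
    (hp : ∀ z, ∑ i ∈ s with y i = z, v i ≤ 1) (L : ℕ) (hL : ∀ i ∈ s, ∀ n ∈ Λ i, n < L) (k : ℕ) :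
    ∃ W : ι → ℕ → ℝ, (∀ i n, 0 ≤ W i n) ∧ (∀ i n, v i = 0 → W i n = 0) ∧
      (∀ i n, n + k < L → W i n = 0) ∧ (∀ z, cover F s y Λ W z ≤ 1) ∧
      ∀ i ∈ s, ∀ n ∈ Λ i, L ≤ n + k → v i * (1 - cover F s y Λ W (y i)
        - cover (outerBoundary F) s y Λ W (y i)) ≤ W i n * ((F n).card : ℝ) := by
  induction k with
  | zero =>
    refine ⟨fun _ _ => 0, by simp, by simp, by simp, by simp [cover], ?_⟩
    intro i hi n hn h
    have := hL i hi n hn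
    omega
  | succ k ih =>
    obtain ⟨W, hW0, hWv, hWL, hW1, hW⟩ := ih
    by_cases hk : L ≤ k
    · refine ⟨W, hW0, hWv, fun i n h => hWL i n (by omega), hW1, fun i hi n hn _ => ?_⟩
      exact hW i hi n hn (by omega)
    obtain ⟨m, hm⟩ : ∃ m, L = m + (k + 1) := ⟨L - (k + 1), by omega⟩
    set U := cover F s y Λ W with hU
    let u : G → ℝ := fun c => (F m).sup' (hne m) fun h => U (h * c)
    have hu1 : ∀ c, u c ≤ 1 := fun c => Finset.sup'_le _ _ fun h _ => hW1 _
    have hcm : (0 : ℝ) < (F m).card := by exact_mod_cast (hne m).card_pos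
    let W' : ι → ℕ → ℝ := fun i n =>
      W i n + if n = m then v i * (1 - u (y i)) / (F m).card else 0
    have hadd : ∀ i, 0 ≤ v i * (1 - u (y i)) / (F m).card := fun i =>
      div_nonneg (mul_nonneg (hv i) (sub_nonneg.2 (hu1 _))) hcm.le
    have hWW' : ∀ i n, W i n ≤ W' i n := by
      intro i n
      simp only [W']
      split_ifs
      · linarith [hadd i]
      · simp
    have hmono : ∀ (E : ℕ → Finset G) z, cover E s y Λ W z ≤ cover E s y Λ W' z := by
      intro E z
      unfold cover
      gcongr with i hi n hn
      exact hWW' i n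
    -- a tile of level above `m` that meets `F m * c` has `c` in it or in its outer boundary
    have hu : ∀ c, u c ≤ U c + cover (outerBoundary F) s y Λ W c := by
      intro c
      refine Finset.sup'_le _ _ fun h hh => ?_
      rw [hU]
      unfold cover
      rw [← Finset.sum_add_distrib]
      refine Finset.sum_le_sum fun i _ => ?_
      rw [← Finset.sum_add_distrib]
      refine Finset.sum_le_sum fun n _ => ?_
      rw [← mul_add]
      by_cases hn : n ≤ m
      · rw [hWL i n (by omega)]; simp
      refine mul_le_mul_of_nonneg_left ?_ (hW0 i n)
      by_cases h1 : h * c * (y i)⁻¹ ∈ F n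
      · by_cases h2 : c * (y i)⁻¹ ∈ F n
        · simp only [h1, h2, if_true]
          split_ifs <;> simp
        · have h3 : c * (y i)⁻¹ ∈ outerBoundary F n := by
            unfold outerBoundary
            simp only [Finset.mem_sdiff, Finset.mem_biUnion, Finset.mem_range]
            refine ⟨⟨m, by omega, Finset.mem_mul.2
              ⟨h⁻¹, Finset.inv_mem_inv hh, h * c * (y i)⁻¹, h1, by group⟩⟩, h2⟩
          simp [h1, h2, h3]
      · rw [if_neg h1]
        split_ifs <;> norm_num
    refine ⟨W', fun i n => (hW0 i n).trans (hWW' i n), ?_, ?_, ?_, ?_⟩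
    · intro i n h
      simp [W', h, hWv i n h]
    · intro i n h
      have : n ≠ m := by omega
      simp [W', this, hWL i n (by omega)]
    · intro z
      have h1 : cover F s y Λ W' z ≤ U z + ∑ i ∈ s,
          v i * (1 - u (y i)) / (F m).card * (if z * (y i)⁻¹ ∈ F m then 1 else 0) := by
        rw [hU]
        unfold cover
        rw [← Finset.sum_add_distrib]
        refine Finset.sum_le_sum fun i _ => ?_
        simp only [W', add_mul, ite_mul, zero_mul]
        rw [Finset.sum_add_distrib]
        gcongr
        rw [Finset.sum_ite_eq']
        have := hadd i
        split_ifs <;> simp [this]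
      have h2 : ∑ i ∈ s,
          v i * (1 - u (y i)) / (F m).card * (if z * (y i)⁻¹ ∈ F m then (1 : ℝ) else 0)
          ≤ (1 - U z) / (F m).card * ∑ i ∈ s,
            v i * (if ∃ h ∈ F m, y i = h⁻¹ * z then (1 : ℝ) else 0) := by
        rw [Finset.mul_sum]
        refine Finset.sum_le_sum fun i _ => ?_
        by_cases h : z * (y i)⁻¹ ∈ F m
        · have h' : ∃ h ∈ F m, y i = h⁻¹ * z := ⟨_, h, by group⟩
          rw [if_pos h, if_pos h', mul_one, mul_one, mul_comm (v i), div_mul_eq_mul_div]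
          gcongr
          · exact hv i
          · have : U (z * (y i)⁻¹ * y i) ≤ u (y i) :=
              Finset.le_sup' (fun h => U (h * y i)) h
            simpa using this
        · rw [if_neg h, mul_zero]
          have := hW1 z
          have := hv i
          refine mul_nonneg (div_nonneg (by linarith) hcm.le) (mul_nonneg this ?_)
          split_ifs <;> simp
      have h3 := sum_demand_le hp (F m) (fun h => h⁻¹ * z)
        (fun a b hab => by simpa using hab)
      have h4 : (1 - U z) / (F m).card * ∑ i ∈ s,
            v i * (if ∃ h ∈ F m, y i = h⁻¹ * z then (1 : ℝ) else 0) ≤ 1 - U z := by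
        calc _ ≤ (1 - U z) / (F m).card * (F m).card :=
              mul_le_mul_of_nonneg_left h3 (div_nonneg (by linarith [hW1 z]) hcm.le)
          _ = _ := by field_simp
      linarith
    · intro i hi n hn h
      have hmF := hmono F (y i)
      have hmB := hmono (outerBoundary F) (y i)
      rcases Nat.lt_or_ge m n with hmn | hmn
      · refine le_trans ?_ ((hW i hi n hn (by omega)).trans ?_)
        · exact mul_le_mul_of_nonneg_left (by linarith) (hv i)
        · exact mul_le_mul_of_nonneg_right (hWW' i n) (Nat.cast_nonneg _)
      · obtain rfl : n = m := by omega
        have : W' i n * (F n).card = v i * (1 - u (y i)) := by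
          simp only [W', hWL i n (by omega), if_true, zero_add]
          field_simp
        rw [this]
        exact mul_le_mul_of_nonneg_left (by linarith [hu (y i)]) (hv i)

open scoped Classical in
/-- Covering lemma: each item can be offered `r` levels of tiles, and the packing then either has
large mass or leaves little of the demand uncovered. -/
theorem exists_packing {l : ℝ} (hne : ∀ n, (F n).Nonempty) (hF : IsGood l F)
    {v : ι → ℝ} (hv : ∀ i, 0 ≤ v i)
    (hp : ∀ z, ∑ i ∈ s with y i = z, v i ≤ 1) {r : ℕ} (hr : ∀ i ∈ s, (Λ i).card = r)
    {L : ℕ} (hL : ∀ i ∈ s, ∀ n ∈ Λ i, n < L) :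
    ∃ W : ι → ℕ → ℝ, (∀ i n, 0 ≤ W i n) ∧ (∀ i n, v i = 0 → W i n = 0) ∧
      (∀ z, cover F s y Λ W z ≤ 1) ∧
      r * ∑ i ∈ s, v i * (1 - cover F s y Λ W (y i)) ≤ (1 + r * l) * mass F s Λ W := by
  obtain ⟨W, hW0, hWv, -, hW1, hW⟩ := exists_greedy_packing (Λ := Λ) (F := F) hne hv hp L hL L
  refine ⟨W, hW0, hWv, hW1, ?_⟩
  set R := cover (outerBoundary F) s y Λ W with hR
  have h1 : ∑ i ∈ s, v i * R (y i) ≤ l * mass F s Λ W := by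
    calc ∑ i ∈ s, v i * R (y i)
        = ∑ j ∈ s, ∑ n ∈ Λ j, W j n * ∑ i ∈ s, v i *
          (if ∃ h ∈ outerBoundary F n, y i = h * y j then (1 : ℝ) else 0) := by
          simp only [hR, cover, Finset.mul_sum]
          rw [Finset.sum_comm]
          refine Finset.sum_congr rfl fun j _ => ?_
          rw [Finset.sum_comm]
          refine Finset.sum_congr rfl fun n _ => Finset.sum_congr rfl fun i _ => ?_
          have : (y i * (y j)⁻¹ ∈ outerBoundary F n) ↔
              ∃ h ∈ outerBoundary F n, y i = h * y j := by
            constructor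
            · intro h; exact ⟨_, h, by group⟩
            · rintro ⟨h, hh, e⟩; simpa [e] using hh
          simp only [this]
          ring
      _ ≤ ∑ j ∈ s, ∑ n ∈ Λ j, W j n * (l * (F n).card) := by
          refine Finset.sum_le_sum fun j _ => Finset.sum_le_sum fun n _ => ?_
          refine mul_le_mul_of_nonneg_left ?_ (hW0 j n)
          refine (sum_demand_le hp _ (fun h => h * y j) (mul_left_injective _)).trans ?_
          have := hF.1 n
          unfold outerBoundary
          convert this
      _ = l * mass F s Λ W := by
          simp only [mass, Finset.mul_sum]
          refine Finset.sum_congr rfl fun j _ => Finset.sum_congr rfl fun n _ => by ring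
  have h2 : ∑ i ∈ s, r * (v i * (1 - cover F s y Λ W (y i) - R (y i))) ≤ mass F s Λ W := by
    unfold mass
    refine Finset.sum_le_sum fun i hi => ?_
    rw [← hr i hi, ← nsmul_eq_mul]
    exact Finset.card_nsmul_le_sum _ _ _ fun n hn => hW i hi n hn (by omega)
  rw [← Finset.mul_sum] at h2
  simp only [mul_sub _ _ (R _), Finset.sum_sub_distrib] at h2
  rw [mul_sub] at h2
  have : (r : ℝ) * ∑ i ∈ s, v i * R (y i) ≤ r * (l * mass F s Λ W) :=
    mul_le_mul_of_nonneg_left h1 (Nat.cast_nonneg _)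
  linarith
end

/-! ### Growth of the mass across a gap -/

section
variable {G : Type*} [Group G] {F : ℕ → Finset G}

/-- A weighted family of tiles `F n * a`, with `a ∈ D` and `n ∈ Λ a`, that is a packing of `Ω` up
to a small error: the excess of its multiplicity over one has total at most `2 * l` times its
mass. -/
structure NearPacking (F : ℕ → Finset G) (D Ω : Finset G) (Λ : G → Finset ℕ) (l : ℝ)
    (w : G → ℕ → ℝ) : Prop where
  nonneg : ∀ a n, 0 ≤ w a n
  excess : ∑ z ∈ Ω, max (cover F D id Λ w z - 1) 0 ≤ 2 * l * mass F D Λ w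
  mass_le : mass F D Λ w ≤ Ω.card

open scoped Classical in
/-- Moving a tile `A * a` to `A * (h * a)` costs little in `ℓ¹` when `A * h` is close to `A`. -/
theorem sum_abs_indicator_sub_le {A Ω : Finset G} {a h : G} {ε : ℝ}
    (hA : ((A \ (A * {h})).card : ℝ) ≤ ε) :
    ∑ z ∈ Ω, |(if z * a⁻¹ ∈ A then (1 : ℝ) else 0) - (if z * (h * a)⁻¹ ∈ A then 1 else 0)|
      ≤ 2 * ε := by
  set B := A * {h} with hB
  have hle : ∀ C : Finset G, ∑ z ∈ Ω, (if z * a⁻¹ ∈ C then (1 : ℝ) else 0) ≤ C.card := by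
    intro C
    rw [← Finset.sum_filter, Finset.sum_const, nsmul_eq_mul, mul_one]
    exact_mod_cast Finset.card_le_card_of_injOn (fun z => z * a⁻¹) (by intro z; simp)
      (fun x _ y _ hxy => by simpa using hxy)
  have hcard : (B \ A).card = (A \ B).card :=
    Finset.card_sdiff_comm (by rw [hB, Finset.card_mul_singleton])
  have hmem : ∀ z, z * (h * a)⁻¹ ∈ A ↔ z * a⁻¹ ∈ B := by
    intro z
    rw [hB, Finset.mem_mul]
    constructor
    · intro hz; exact ⟨_, hz, h, Finset.mem_singleton_self h, by group⟩
    · rintro ⟨x, hx, y, hy, e⟩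
      rw [Finset.mem_singleton.1 hy] at e
      have : z * (h * a)⁻¹ = x := by rw [mul_inv_rev, ← mul_assoc, ← e]; group
      rwa [this]
  calc _ = ∑ z ∈ Ω, ((if z * a⁻¹ ∈ A \ B then (1 : ℝ) else 0)
        + (if z * a⁻¹ ∈ B \ A then 1 else 0)) := by
        refine Finset.sum_congr rfl fun z _ => ?_
        simp only [hmem, Finset.mem_sdiff]
        by_cases h1 : z * a⁻¹ ∈ A <;> by_cases h2 : z * a⁻¹ ∈ B <;> simp [h1, h2]
    _ ≤ (A \ B).card + (B \ A).card := by
        rw [Finset.sum_add_distrib]; exact add_le_add (hle _) (hle _)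
    _ ≤ 2 * ε := by rw [hcard]; linarith

/-- The numerical core of the growth estimate. Here `M` and `M'` are the masses of two consecutive
families of tiles, `E` is the excess of the first one over a packing, and `P` the part of it that
the second one leaves uncovered. -/
theorem growth_of_gap {α β S T c l r M M' E P : ℝ} (hS : 0 ≤ S) (hT : S + |β| ≤ T) (hc : 0 ≤ c)
    (hc1 : c ≤ 1) (hl : 0 ≤ l) (hr : 0 < r) (hrl : r * l ≤ 1)
    (hgap : T * (c + 8 * l + 8 / r) < β - α) (hM : 0 ≤ M) (hM' : 0 ≤ M') (hE0 : 0 ≤ E)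
    (hP0 : 0 ≤ P) (hE : E ≤ 2 * l * M) (hP : r * P ≤ (1 + r * l) * M') (hPM : M - E - P ≤ M')
    (h : β * M' - α * M ≤ S * (2 * l * M' + (M' - (M - E) + 2 * P) + E)) :
    (1 + c) * M ≤ M' := by
  by_contra! hlt
  have hMpos : 0 < M := by
    rcases hM.eq_or_lt with h0 | h0
    · rw [← h0] at hlt; linarith
    · exact h0
  have hP' : P ≤ 4 / r * M := by
    rw [div_mul_eq_mul_div, le_div_iff₀ hr]
    have : (1 + r * l) * M' ≤ 2 * (2 * M) := by
      refine mul_le_mul (by linarith) ?_ hM' (by norm_num)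
      nlinarith
    linarith
  have h8 : 8 / r = 2 * (4 / r) := by ring
  rw [h8] at hgap
  set δ := 4 / r
  have hδ : 0 ≤ δ := by positivity
  have h2 : 2 * l * M' ≤ 2 * l * (2 * M) :=
    mul_le_mul_of_nonneg_left (by nlinarith) (by linarith)
  have h3 : S * (2 * l * M' + (M' - (M - E) + 2 * P) + E)
      ≤ S * ((c + 8 * l + 2 * δ) * M) := mul_le_mul_of_nonneg_left (by linarith) hS
  have h4 : |M' - M| ≤ (c + 8 * l + 2 * δ) * M := by
    have := mul_nonneg hδ hM
    have := mul_nonneg hl hM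
    have := mul_nonneg hc hM
    rw [abs_le]
    constructor <;> linarith
  have h5 : -(β * (M' - M)) ≤ |β| * ((c + 8 * l + 2 * δ) * M) := by
    refine (neg_le_abs _).trans ?_
    rw [abs_mul]
    exact mul_le_mul_of_nonneg_left h4 (abs_nonneg _)
  have h6 : (S + |β|) * ((c + 8 * l + 2 * δ) * M) ≤ T * ((c + 8 * l + 2 * δ) * M) :=
    mul_le_mul_of_nonneg_right hT (by positivity)
  have h7 := mul_lt_mul_of_pos_right hgap hMpos
  nlinarith

open scoped Classical in
/-- One step of the growth: a near packing by tiles with averages at most `α` yields a near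
packing by tiles of higher levels, at the same base points, with averages at least `β` and with
mass larger by the factor `1 + c`. If the mass did not grow, then by the covering lemma both
coverings would be close in `ℓ¹`, which contradicts the gap between the averages. -/
theorem NearPacking.exists_growth {D Y Ω : Finset G} {Λ Λ' : G → Finset ℕ} {l : ℝ}
    {w : G → ℕ → ℝ} {φ : G → ℝ} {α β S T c : ℝ} {r L : ℕ} (hw : NearPacking F D Ω Λ l w)
    (hne : ∀ n, (F n).Nonempty) (hF : IsGood l F)
    (hDY : D ⊆ Y) (hYΩ : Y ⊆ Ω)
    (hYΩ' : ∀ y ∈ Y, ∀ n < L, ∀ h ∈ F n, h * y ∈ Ω)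
    (hY : ∀ a ∈ D, ∀ n ∈ Λ a, ∀ h ∈ F n, h * a ∈ Y)
    (hΛ' : ∀ a ∈ D, ∀ n ∈ Λ' a, n < L) (hr' : ∀ a ∈ D, (Λ' a).card = r)
    (hΛΛ' : ∀ a ∈ D, ∀ n ∈ Λ a, ∀ m ∈ Λ' a, n < m)
    (hφS : ∀ g, |φ g| ≤ S)
    (hφ : ∀ a ∈ D, ∀ n ∈ Λ a, ∑ h ∈ F n, φ (h * a) ≤ α * (F n).card)
    (hφ' : ∀ a ∈ D, ∀ n ∈ Λ' a, β * (F n).card ≤ ∑ h ∈ F n, φ (h * a))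
    (hT : S + |β| ≤ T) (hc : 0 ≤ c) (hc1 : c ≤ 1) (hl : 0 ≤ l) (hr : 0 < r)
    (hrl : (r : ℝ) * l ≤ 1) (hgap : T * (c + 8 * l + 8 / r) < β - α) :
    ∃ w' : G → ℕ → ℝ, NearPacking F D Ω Λ' l w' ∧
      (1 + c) * mass F D Λ w ≤ mass F D Λ' w' := by
  have hw0 := hw.nonneg
  set V := cover F D id Λ w with hV
  set M := mass F D Λ w with hM
  have hV0 : ∀ z, 0 ≤ V z := cover_nonneg hw0
  have hmax : ∀ z, 0 < max (V z) 1 := fun z => lt_max_of_lt_right one_pos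
  have hmin : ∀ z, V z / max (V z) 1 = min (V z) 1 := by
    intro z
    rcases le_total (V z) 1 with h | h
    · simp [h]
    · rw [max_eq_left h, min_eq_right h, div_self (by linarith)]
  -- the demand `v (a, y)` at `y` is the share of `min (V y) 1` that is due to tiles based at `a`
  let v : G × G → ℝ := fun i =>
    (∑ n ∈ Λ i.1, w i.1 n * (if i.2 * i.1⁻¹ ∈ F n then 1 else 0)) / max (V i.2) 1
  have hv : ∀ i, 0 ≤ v i := by
    intro i
    refine div_nonneg (Finset.sum_nonneg fun n _ => mul_nonneg (hw0 _ _) ?_) (hmax _).le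
    split_ifs <;> simp
  have hvsum : ∀ z, ∑ a ∈ D, v (a, z) = min (V z) 1 := by
    intro z
    rw [← hmin, hV, cover, Finset.sum_div]
    rfl
  let Λ'' : G × G → Finset ℕ := fun i => Λ' i.1
  obtain ⟨W, hW0, hWv, hW1, hW⟩ := exists_packing (s := D ×ˢ Y) (y := Prod.snd) (v := v)
    (Λ := Λ'') (r := r) (L := L) hne hF hv
    (by
      intro z
      rw [Finset.sum_filter, Finset.sum_product]
      simp only [Finset.sum_ite_eq']
      calc _ ≤ ∑ a ∈ D, v (a, z) := Finset.sum_le_sum fun a _ => by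
            split_ifs
            · exact le_rfl
            · exact hv _
        _ ≤ 1 := by rw [hvsum]; exact min_le_right _ _)
    (fun i hi => hr' _ (Finset.mem_product.1 hi).1)
    (fun i hi => hΛ' _ (Finset.mem_product.1 hi).1)
  set U := cover F (D ×ˢ Y) Prod.snd Λ'' W with hU
  set M' := mass F (D ×ˢ Y) Λ'' W with hM'
  -- a tile `F m * y` assigned to the pair `(a, y)` is moved back to the base point `a`
  let w' : G → ℕ → ℝ := fun a m => ∑ y ∈ Y, W (a, y) m
  have hw'0 : ∀ a n, 0 ≤ w' a n := fun a n => Finset.sum_nonneg fun y _ => hW0 _ _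
  have hmass : mass F D Λ' w' = M' := by
    rw [hM', mass, mass, Finset.sum_product]
    refine Finset.sum_congr rfl fun a _ => ?_
    change _ = ∑ y ∈ Y, ∑ n ∈ Λ' a, W (a, y) n * ((F n).card : ℝ)
    rw [Finset.sum_comm]
    refine Finset.sum_congr rfl fun n _ => ?_
    rw [Finset.sum_mul]
  set V' := cover F D id Λ' w' with hV'
  have hV'eq : ∀ z, V' z = ∑ i ∈ D ×ˢ Y, ∑ n ∈ Λ'' i,
      W i n * (if z * (i.1)⁻¹ ∈ F n then 1 else 0) := by
    intro z
    rw [hV', cover, Finset.sum_product]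
    refine Finset.sum_congr rfl fun a _ => ?_
    change _ = ∑ y ∈ Y, ∑ n ∈ Λ' a, W (a, y) n * (if z * a⁻¹ ∈ F n then 1 else 0)
    rw [Finset.sum_comm]
    refine Finset.sum_congr rfl fun n _ => ?_
    rw [Finset.sum_mul]
    rfl
  -- since `y ∈ F m * a` for some lower level `m`, moving the tiles changes little
  have hdiff : ∑ z ∈ Ω, |V' z - U z| ≤ 2 * l * M' := by
    calc ∑ z ∈ Ω, |V' z - U z|
        ≤ ∑ z ∈ Ω, ∑ i ∈ D ×ˢ Y, ∑ n ∈ Λ'' i, W i n *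
          |(if z * (i.1)⁻¹ ∈ F n then (1 : ℝ) else 0) - (if z * (i.2)⁻¹ ∈ F n then 1 else 0)| := by
          refine Finset.sum_le_sum fun z _ => ?_
          rw [hV'eq, hU, cover, ← Finset.sum_sub_distrib]
          refine (Finset.abs_sum_le_sum_abs _ _).trans (Finset.sum_le_sum fun i _ => ?_)
          rw [← Finset.sum_sub_distrib]
          refine (Finset.abs_sum_le_sum_abs _ _).trans (Finset.sum_le_sum fun n _ => ?_)
          rw [← mul_sub, abs_mul, abs_of_nonneg (hW0 i n)]
      _ = ∑ i ∈ D ×ˢ Y, ∑ n ∈ Λ'' i, W i n * ∑ z ∈ Ω,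
          |(if z * (i.1)⁻¹ ∈ F n then (1 : ℝ) else 0) - (if z * (i.2)⁻¹ ∈ F n then 1 else 0)| := by
          rw [Finset.sum_comm]
          refine Finset.sum_congr rfl fun i _ => ?_
          rw [Finset.sum_comm]
          refine Finset.sum_congr rfl fun n _ => ?_
          rw [Finset.mul_sum]
      _ ≤ ∑ i ∈ D ×ˢ Y, ∑ n ∈ Λ'' i, W i n * (2 * (l * (F n).card)) := by
          refine Finset.sum_le_sum fun i hi => Finset.sum_le_sum fun n hn => ?_
          by_cases h0 : v i = 0
          · rw [hWv i n h0]; simp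
          refine mul_le_mul_of_nonneg_left ?_ (hW0 i n)
          obtain ⟨m, hm, hmF⟩ : ∃ m ∈ Λ i.1, i.2 * i.1⁻¹ ∈ F m := by
            by_contra! hno
            refine h0 ?_
            simp only [v]
            rw [Finset.sum_eq_zero, zero_div]
            intro m hm
            simp [hno m hm]
          have hmn := hΛΛ' i.1 (Finset.mem_product.1 hi).1 m hm n hn
          have := sum_abs_indicator_sub_le (Ω := Ω) (a := i.1) (hF.2 m n hmn _ hmF).le
          simpa using this
      _ = 2 * l * M' := by
          simp only [hM', mass, Finset.mul_sum]
          refine Finset.sum_congr rfl fun j _ => Finset.sum_congr rfl fun n _ => by ring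
  have hM'sum : ∑ z ∈ Ω, U z = M' := sum_cover fun i hi n hn h hh =>
    hYΩ' _ (Finset.mem_product.1 hi).2 n (hΛ' _ (Finset.mem_product.1 hi).1 n hn) h hh
  have hU0 : ∀ z, 0 ≤ U z := cover_nonneg hW0
  have hVΩ : ∀ a ∈ D, ∀ n ∈ Λ a, ∀ h ∈ F n, h * id a ∈ Ω :=
    fun a ha n hn h hh => hYΩ (hY a ha n hn h hh)
  have hV'Ω : ∀ a ∈ D, ∀ n ∈ Λ' a, ∀ h ∈ F n, h * id a ∈ Ω :=
    fun a ha n hn h hh => hYΩ' a (hDY ha) n (hΛ' a ha n hn) h hh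
  refine ⟨w', ⟨hw'0, ?_, ?_⟩, ?_⟩
  · rw [hmass]
    refine le_trans (Finset.sum_le_sum fun z _ => ?_) hdiff
    refine max_le ?_ (abs_nonneg _)
    exact le_trans (by linarith [hW1 z]) (le_abs_self _)
  · rw [hmass, ← hM'sum]
    calc _ ≤ ∑ z ∈ Ω, (1 : ℝ) := Finset.sum_le_sum fun z _ => hW1 z
      _ = _ := by simp
  · rw [hmass]
    have hVout : ∀ z, z ∉ Y → V z = 0 := by
      intro z hz
      rw [hV, cover]
      refine Finset.sum_eq_zero fun a ha => Finset.sum_eq_zero fun n hn => ?_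
      rw [if_neg, mul_zero]
      intro h
      exact hz (by simpa using hY a ha n hn _ h)
    have hPsum : ∑ i ∈ D ×ˢ Y, v i * (1 - U i.2) = ∑ z ∈ Ω, min (V z) 1 * (1 - U z) := by
      rw [Finset.sum_product_right, ← Finset.sum_subset hYΩ]
      · refine Finset.sum_congr rfl fun z _ => ?_
        rw [← hvsum, Finset.sum_mul]
      · intro z _ hz
        simp [hVout z hz]
    rw [hPsum] at hW
    have hMsum : ∑ z ∈ Ω, V z = M := sum_cover hVΩ
    have hEsum : ∑ z ∈ Ω, min (V z) 1 = M - ∑ z ∈ Ω, max (V z - 1) 0 := by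
      rw [← hMsum, ← Finset.sum_sub_distrib]
      refine Finset.sum_congr rfl fun z _ => ?_
      rcases le_total (V z) 1 with h | h
      · rw [min_eq_left h, max_eq_right (by linarith)]; ring
      · rw [min_eq_right h, max_eq_left (by linarith)]; ring
    have hmin0 : ∀ z, 0 ≤ min (V z) 1 := fun z => le_min (hV0 z) zero_le_one
    refine growth_of_gap (S := S) (E := ∑ z ∈ Ω, max (V z - 1) 0)
      (P := ∑ z ∈ Ω, min (V z) 1 * (1 - U z)) ((abs_nonneg _).trans (hφS 1)) hT hc hc1 hl
      (by exact_mod_cast hr) hrl hgap (mass_nonneg hw0) (mass_nonneg hW0)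
      (Finset.sum_nonneg fun z _ => le_max_right _ _)
      (Finset.sum_nonneg fun z _ => mul_nonneg (hmin0 z) (by linarith [hW1 z]))
      hw.excess hW ?_ ?_
    · rw [← hEsum, ← hM'sum, ← Finset.sum_sub_distrib]
      refine Finset.sum_le_sum fun z _ => ?_
      nlinarith [hU0 z, hmin0 z, min_le_right (V z) 1]
    · have h1 : β * M' ≤ ∑ z ∈ Ω, V' z * φ z := by
        rw [hV', sum_cover_mul hV'Ω, ← hmass, mass, Finset.mul_sum]
        refine Finset.sum_le_sum fun a ha => ?_
        rw [Finset.mul_sum]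
        refine Finset.sum_le_sum fun n hn => ?_
        have := mul_le_mul_of_nonneg_left (hφ' a ha n hn) (hw'0 a n)
        simp only [id]
        linarith
      have h2 : ∑ z ∈ Ω, V z * φ z ≤ α * M := by
        rw [hV, sum_cover_mul hVΩ, hM, mass, Finset.mul_sum]
        refine Finset.sum_le_sum fun a ha => ?_
        rw [Finset.mul_sum]
        refine Finset.sum_le_sum fun n hn => ?_
        have := mul_le_mul_of_nonneg_left (hφ a ha n hn) (hw0 a n)
        simp only [id]
        linarith
      have h3 : ∑ z ∈ Ω, V' z * φ z - ∑ z ∈ Ω, V z * φ z ≤ S * ∑ z ∈ Ω, |V' z - V z| := by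
        rw [← Finset.sum_sub_distrib, Finset.mul_sum]
        refine Finset.sum_le_sum fun z _ => ?_
        rw [← sub_mul, mul_comm S]
        refine (le_abs_self _).trans ?_
        rw [abs_mul]
        exact mul_le_mul_of_nonneg_left (hφS z) (abs_nonneg _)
      have h4 : ∑ z ∈ Ω, |V' z - V z| ≤ ∑ z ∈ Ω, (|V' z - U z|
          + (U z - min (V z) 1 + 2 * (min (V z) 1 * (1 - U z))) + max (V z - 1) 0) := by
        refine Finset.sum_le_sum fun z _ => ?_
        have ha : |U z - min (V z) 1| ≤ U z - min (V z) 1 + 2 * (min (V z) 1 * (1 - U z)) := by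
          have := hU0 z
          have := hW1 z
          have := hmin0 z
          have := min_le_right (V z) 1
          rw [abs_le]
          constructor <;> nlinarith
        have hb : |min (V z) 1 - V z| = max (V z - 1) 0 := by
          rcases le_total (V z) 1 with h | h
          · rw [min_eq_left h, max_eq_right (by linarith)]; simp
          · rw [min_eq_right h, max_eq_left (by linarith), abs_sub_comm, abs_of_nonneg]
            linarith
        rw [← hb]
        have := abs_sub_le (V' z) (U z) (V z)
        have := abs_sub_le (U z) (min (V z) 1) (V z)
        linarith
      rw [Finset.sum_add_distrib, Finset.sum_add_distrib, Finset.sum_add_distrib,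
        Finset.sum_sub_distrib, hM'sum, hEsum, ← Finset.mul_sum] at h4
      have hS : 0 ≤ S := (abs_nonneg _).trans (hφS 1)
      have h5 := mul_le_mul_of_nonneg_left
        (h4.trans (add_le_add_left (add_le_add_left hdiff _) _)) hS
      linarith

open scoped Classical in
/-- The initial packing, with mass at least a third of the number of base points. -/
theorem exists_nearPacking {D Ω : Finset G} {Λ : G → Finset ℕ} {l : ℝ} {r L : ℕ}
    (hne : ∀ n, (F n).Nonempty) (hF : IsGood l F)
    (hDΩ : D ⊆ Ω) (hΩ : ∀ a ∈ D, ∀ n ∈ Λ a, ∀ h ∈ F n, h * a ∈ Ω)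
    (hΛ : ∀ a ∈ D, ∀ n ∈ Λ a, n < L) (hr' : ∀ a ∈ D, (Λ a).card = r)
    (hl : 0 ≤ l) (hr : 0 < r) (hrl : (r : ℝ) * l ≤ 1) :
    ∃ w : G → ℕ → ℝ, NearPacking F D Ω Λ l w ∧ (D.card : ℝ) ≤ 3 * mass F D Λ w := by
  obtain ⟨w, hw0, -, hw1, hw⟩ := exists_packing (s := D) (y := id) (v := fun _ => 1)
    (Λ := Λ) (r := r) (L := L) hne hF (fun _ => zero_le_one)
    (by
      intro z
      rw [Finset.sum_filter]
      simp only [id, Finset.sum_ite_eq']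
      split_ifs <;> simp) hr' hΛ
  have hM : ∑ z ∈ Ω, cover F D id Λ w z = mass F D Λ w := sum_cover hΩ
  have hM0 : 0 ≤ mass F D Λ w := mass_nonneg hw0
  refine ⟨w, ⟨hw0, ?_, ?_⟩, ?_⟩
  · rw [Finset.sum_eq_zero]
    · positivity
    · intro z _
      exact max_eq_right (by linarith [hw1 z])
  · rw [← hM]
    calc _ ≤ ∑ z ∈ Ω, (1 : ℝ) := Finset.sum_le_sum fun z _ => hw1 z
      _ = _ := by simp
  · have h1 : ∑ z ∈ D, cover F D id Λ w z ≤ mass F D Λ w := by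
      rw [← hM]
      exact Finset.sum_le_sum_of_subset_of_nonneg hDΩ fun z _ _ => cover_nonneg hw0 z
    simp only [one_mul, id, Finset.sum_sub_distrib, Finset.sum_const, nsmul_eq_mul, mul_one] at hw
    have hr1 : (1 : ℝ) ≤ r := by exact_mod_cast hr
    have h2 : (1 + r * l) * mass F D Λ w ≤ (r * 2) * mass F D Λ w :=
      mul_le_mul_of_nonneg_right (by linarith) hM0
    have h3 : (r : ℝ) * (D.card - mass F D Λ w) ≤ r * (2 * mass F D Λ w) := by
      refine le_trans (mul_le_mul_of_nonneg_left ?_ (by linarith)) (hw.trans (by linarith))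
      linarith
    have := le_of_mul_le_mul_left h3 (by linarith)
    linarith
end

/-! ### Iteration over blocks of levels -/

section
variable {G : Type*} [Group G] {F : ℕ → Finset G}

/-- The `k`-th block of levels at the base point `a`: among the indices
`2 * r * k < i ≤ 2 * r * (k + 1)` it takes the levels `n a i` with `i` odd if `k` is even, and with
`i` even if `k` is odd. Hence the averages over the tiles of one block lie on one side of the gap,
alternating with `k`. -/
def block (n : G → ℕ → ℕ) (r k : ℕ) (a : G) : Finset ℕ :=
  (Finset.range r).image fun j => n a (2 * (r * k + j) + 1 + k % 2)

/-- Iterating the growth step over the blocks: if every point of `D` fluctuates `N` times, there are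
near packings whose mass is at least `|D| (1 + c) ^ k / 3`. -/
theorem exists_nearPacking_block {D Y Ω : Finset G} {l : ℝ}
    {φ : G → ℝ} {α β S T c : ℝ} {r L N : ℕ} {n : G → ℕ → ℕ}
    (hne : ∀ m, (F m).Nonempty) (hF : IsGood l F)
    (hDY : D ⊆ Y) (hYΩ : Y ⊆ Ω)
    (hDY' : ∀ a ∈ D, ∀ m < L, ∀ h ∈ F m, h * a ∈ Y)
    (hYΩ' : ∀ y ∈ Y, ∀ m < L, ∀ h ∈ F m, h * y ∈ Ω)
    (hn : ∀ a ∈ D, StrictMonoOn (n a) (Set.Icc 1 (2 * N)))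
    (hnL : ∀ a ∈ D, ∀ i ∈ Set.Icc 1 (2 * N), n a i < L)
    (hφS : ∀ g, |φ g| ≤ S)
    (hodd : ∀ a ∈ D, ∀ i ∈ Set.Icc 1 (2 * N), Odd i →
      ∑ h ∈ F (n a i), φ (h * a) ≤ α * (F (n a i)).card)
    (heven : ∀ a ∈ D, ∀ i ∈ Set.Icc 1 (2 * N), Even i →
      β * (F (n a i)).card ≤ ∑ h ∈ F (n a i), φ (h * a))
    (hTα : S + |α| ≤ T) (hTβ : S + |β| ≤ T) (hc : 0 ≤ c) (hc1 : c ≤ 1) (hl : 0 ≤ l) (hr : 0 < r)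
    (hrl : (r : ℝ) * l ≤ 1) (hgap : T * (c + 8 * l + 8 / r) < β - α) (k : ℕ)
    (hk : r * (k + 1) ≤ N) :
    ∃ w : G → ℕ → ℝ, NearPacking F D Ω (block n r k) l w ∧
      (D.card : ℝ) * (1 + c) ^ k ≤ 3 * mass F D (block n r k) w := by
  have hidx : ∀ k j, r * (k + 1) ≤ N → j < r →
      2 * (r * k + j) + 1 + k % 2 ∈ Set.Icc 1 (2 * N) := by
    intro k j hk hj
    rw [Set.mem_Icc]
    have : r * (k + 1) = r * k + r := by ring
    omega
  have hL : ∀ k, r * (k + 1) ≤ N → ∀ a ∈ D, ∀ m ∈ block n r k a, m < L := by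
    intro k hk a ha m hm
    obtain ⟨j, hj, rfl⟩ := Finset.mem_image.1 hm
    exact hnL a ha _ (hidx k j hk (Finset.mem_range.1 hj))
  have hcard : ∀ k, r * (k + 1) ≤ N → ∀ a ∈ D, (block n r k a).card = r := by
    intro k hk a ha
    rw [block, Finset.card_image_of_injOn, Finset.card_range]
    intro i hi j hj hij
    have := (hn a ha).injOn (hidx k i hk (Finset.mem_range.1 hi))
      (hidx k j hk (Finset.mem_range.1 hj)) hij
    omega
  induction k with
  | zero =>
    simpa using exists_nearPacking hne hF (hDY.trans hYΩ)
      (fun a ha m hm h hh => hYΩ' a (hDY ha) m (hL 0 hk a ha m hm) h hh)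
      (hL 0 hk) (hcard 0 hk) hl hr hrl
  | succ k ih =>
    have hk' : r * (k + 1) ≤ N := by nlinarith
    obtain ⟨w, hw, hDw⟩ := ih hk'
    have hlt : ∀ a ∈ D, ∀ m ∈ block n r k a, ∀ m' ∈ block n r (k + 1) a, m < m' := by
      intro a ha m hm m' hm'
      obtain ⟨j, hj, rfl⟩ := Finset.mem_image.1 hm
      obtain ⟨j', hj', rfl⟩ := Finset.mem_image.1 hm'
      rw [Finset.mem_range] at hj hj'
      refine hn a ha (hidx k j hk' hj) (hidx (k + 1) j' hk hj') ?_
      have : r * (k + 1) = r * k + r := by ring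
      omega
    have hY : ∀ a ∈ D, ∀ m ∈ block n r k a, ∀ h ∈ F m, h * a ∈ Y :=
      fun a ha m hm h hh => hDY' a ha m (hL k hk' a ha m hm) h hh
    have hlow : ∀ k, r * (k + 1) ≤ N → Even k → ∀ a ∈ D, ∀ m ∈ block n r k a,
        ∑ h ∈ F m, φ (h * a) ≤ α * (F m).card := by
      intro k hk hev a ha m hm
      obtain ⟨j, hj, rfl⟩ := Finset.mem_image.1 hm
      refine hodd a ha _ (hidx k j hk (Finset.mem_range.1 hj)) ?_
      rw [Nat.even_iff.1 hev, Nat.odd_iff]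
      omega
    have hhigh : ∀ k, r * (k + 1) ≤ N → Odd k → ∀ a ∈ D, ∀ m ∈ block n r k a,
        β * (F m).card ≤ ∑ h ∈ F m, φ (h * a) := by
      intro k hk hev a ha m hm
      obtain ⟨j, hj, rfl⟩ := Finset.mem_image.1 hm
      refine heven a ha _ (hidx k j hk (Finset.mem_range.1 hj)) ?_
      rw [Nat.odd_iff.1 hev, Nat.even_iff]
      omega
    obtain ⟨w', hw', hgrow⟩ : ∃ w' : G → ℕ → ℝ, NearPacking F D Ω (block n r (k + 1)) l w' ∧
        (1 + c) * mass F D (block n r k) w ≤ mass F D (block n r (k + 1)) w' := by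
      rcases Nat.even_or_odd k with hpar | hpar
      · exact hw.exists_growth hne hF hDY hYΩ hYΩ' hY (hL _ hk) (hcard _ hk) hlt hφS
          (hlow k hk' hpar) (hhigh (k + 1) hk hpar.add_one) hTβ hc hc1 hl hr hrl hgap
      · -- the roles of `α` and `β` are exchanged by passing to `-φ`
        refine hw.exists_growth (φ := fun g => -φ g) (α := -β) (β := -α) (S := S) (T := T)
          hne hF hDY hYΩ hYΩ' hY (hL _ hk) (hcard _ hk) hlt (fun g => by rw [abs_neg]; exact hφS g)
          ?_ ?_ (by rwa [abs_neg]) hc hc1 hl hr hrl (by linarith)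
        · intro a ha m hm
          have := hhigh k hk' hpar a ha m hm
          rw [Finset.sum_neg_distrib]
          linarith
        · intro a ha m hm
          have := hlow (k + 1) hk hpar.add_one a ha m hm
          rw [Finset.sum_neg_distrib]
          linarith
    refine ⟨w', hw', ?_⟩
    calc (D.card : ℝ) * (1 + c) ^ (k + 1) = (1 + c) * (D.card * (1 + c) ^ k) := by ring
      _ ≤ (1 + c) * (3 * mass F D (block n r k) w) :=
          mul_le_mul_of_nonneg_left hDw (by linarith)
      _ ≤ _ := by linarith
end

/-! ### Invariant finite sets -/

section
open scoped symmDiff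
open Filter MeasureTheory
open scoped Classical in
/-- A Følner sequence contains sets that a given finite set enlarges at most twofold. -/
theorem IsLeftFolner.exists_card_mul_le {G : Type*} [Group G] {F : ℕ → Finset G}
    (hF : IsLeftFolner F) (A : Finset G) :
    ∃ K : Finset G, K.Nonempty ∧ (A * K).card ≤ 2 * K.card := by
  have h1 : ∀ g : G, ∀ᶠ n in atTop, (A.card : ℝ) * ((g • F n) \ F n).card ≤ (F n).card := by
    intro g
    have ht := @IsFoelner.tendsto_meas_smul_symmDiff _ _ ⊤ _ _ _ _ _ _ hF.2 g
    have hpos : (0 : ENNReal) < ((A.card : ENNReal) + 1)⁻¹ := by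
      rw [ENNReal.inv_pos]; finiteness
    filter_upwards [ht.eventually_lt_const hpos] with n hn
    have e1 : (g • (F n : Set G)) ∆ (F n : Set G) = (((g • F n) ∆ F n : Finset G) : Set G) := by
      rw [Finset.coe_symmDiff, Finset.coe_smul_finset]
    rw [e1, @Measure.count_apply_finset' G ⊤ _ trivial,
      @Measure.count_apply_finset' G ⊤ _ trivial] at hn
    have hc : ((F n).card : ENNReal) ≠ 0 := by
      simpa using (hF.1 n).ne_empty
    have h2 : ((A.card : ENNReal) + 1) * (((g • F n) ∆ F n).card : ENNReal) ≤ (F n).card := by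
      have := (ENNReal.div_le_iff hc (by finiteness)).1 hn.le
      rw [mul_comm] at this
      calc _ ≤ ((A.card : ENNReal) + 1) * ((F n).card * ((A.card : ENNReal) + 1)⁻¹) := by gcongr
        _ = (F n).card * (((A.card : ENNReal) + 1) * ((A.card : ENNReal) + 1)⁻¹) := by ring
        _ = _ := by rw [ENNReal.mul_inv_cancel (by simp) (by finiteness), mul_one]
    have h3 : (A.card + 1) * ((g • F n) ∆ F n).card ≤ (F n).card := by exact_mod_cast h2
    have h4 : ((g • F n) \ F n).card ≤ ((g • F n) ∆ F n).card :=
      Finset.card_le_card (le_sup_left : _ ≤ (g • F n) \ F n ⊔ F n \ (g • F n))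
    have : A.card * ((g • F n) \ F n).card ≤ (F n).card := by nlinarith
    exact_mod_cast this
  have h2 : ∀ᶠ n in atTop, ∀ g ∈ A, (A.card : ℝ) * ((g • F n) \ F n).card ≤ (F n).card :=
    (Filter.eventually_all_finset A).2 fun g _ => h1 g
  obtain ⟨n, hn⟩ := h2.exists
  refine ⟨F n, hF.1 n, ?_⟩
  rcases A.eq_empty_or_nonempty with rfl | hA
  · simp
  have h3 : A * F n ⊆ F n ∪ A.biUnion fun g => (g • F n) \ F n := by
    intro z hz
    obtain ⟨a, ha, b, hb, rfl⟩ := Finset.mem_mul.1 hz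
    by_cases h : a * b ∈ F n
    · exact Finset.mem_union_left _ h
    · exact Finset.mem_union_right _ (Finset.mem_biUnion.2
        ⟨a, ha, Finset.mem_sdiff.2 ⟨Finset.smul_mem_smul_finset hb, h⟩⟩)
  have h4 : ((A.biUnion fun g => (g • F n) \ F n).card : ℝ) ≤ (F n).card := by
    have hA' : (0 : ℝ) < A.card := by exact_mod_cast hA.card_pos
    calc ((A.biUnion fun g => (g • F n) \ F n).card : ℝ)
        ≤ ∑ g ∈ A, (((g • F n) \ F n).card : ℝ) := by exact_mod_cast Finset.card_biUnion_le
      _ ≤ ∑ g ∈ A, ((F n).card : ℝ) / A.card := Finset.sum_le_sum fun g hg => by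
          rw [le_div_iff₀ hA', mul_comm]; exact hn g hg
      _ = _ := by rw [Finset.sum_const, nsmul_eq_mul]; field_simp
  have h5 := (Finset.card_le_card h3).trans (Finset.card_union_le _ _)
  have h6 : (A.biUnion fun g => (g • F n) \ F n).card ≤ (F n).card := by exact_mod_cast h4
  omega
end

/-! ### Transference to the probability space -/

section
open Filter MeasureTheory

/-- The points at which the averages fluctuate `N` times across the gap already along the indices
below `L`. -/
def fluctSetBelow {G X : Type*} [Group G] [MulAction G X] (F : ℕ → Finset G) (f : X → ℝ)
    (α β : ℝ) (N L : ℕ) : Set X :=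
  {x | ∃ n : ℕ → ℕ, StrictMonoOn n (Set.Icc 1 (2 * N)) ∧ ∀ i ∈ Set.Icc 1 (2 * N),
    n i < L ∧ (Odd i → avg F f (n i) x ≤ α) ∧ (Even i → β ≤ avg F f (n i) x)}

section
variable {G X : Type*} [Group G] [MulAction G X] {F : ℕ → Finset G} {f : X → ℝ} {α β : ℝ}

theorem fluctSet_eq_iUnion (N : ℕ) :
    fluctSet F f α β N = ⋃ L, fluctSetBelow F f α β N L := by
  ext x
  simp only [fluctSet, Fluctuates, fluctSetBelow, Set.mem_ofPred_eq, Set.mem_iUnion]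
  constructor
  · rintro ⟨n, hn, h⟩
    refine ⟨n (2 * N) + 1, n, hn, fun i hi => ⟨?_, h i hi⟩⟩
    exact Nat.lt_succ_of_le (hn.monotoneOn hi ⟨hi.1.trans hi.2, le_rfl⟩ hi.2)
  · rintro ⟨L, n, hn, h⟩
    exact ⟨n, hn, fun i hi => (h i hi).2⟩

theorem monotone_fluctSetBelow (N : ℕ) : Monotone (fluctSetBelow F f α β N) := by
  rintro L L' hL x ⟨n, hn, h⟩
  exact ⟨n, hn, fun i hi => ⟨(h i hi).1.trans_le hL, (h i hi).2⟩⟩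

theorem measurableSet_fluctSetBelow [MeasurableSpace X] [MeasurableConstSMul G X]
    (hf : Measurable f) (N L : ℕ) : MeasurableSet (fluctSetBelow F f α β N L) := by
  have havg : ∀ m, Measurable (avg F f m) := by
    intro m
    unfold avg
    fun_prop
  -- only finitely many values of `n` matter, so that there are countably many choices
  have : fluctSetBelow F f α β N L = ⋃ p : Fin (2 * N + 1) → ℕ,
      {x | (∀ i j : Fin (2 * N + 1), 1 ≤ (i : ℕ) → i < j → p i < p j) ∧
        ∀ i : Fin (2 * N + 1), 1 ≤ (i : ℕ) →
        p i < L ∧ (Odd (i : ℕ) → avg F f (p i) x ≤ α) ∧ (Even (i : ℕ) → β ≤ avg F f (p i) x)} := by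
    ext x
    simp only [fluctSetBelow, Set.mem_ofPred_eq, Set.mem_iUnion]
    constructor
    · rintro ⟨n, hn, h⟩
      refine ⟨fun i => n i, fun i j hi hij => ?_, fun i hi => h i ⟨hi, by omega⟩⟩
      exact hn ⟨hi, by omega⟩ ⟨by omega, by omega⟩ hij
    · rintro ⟨p, hp, h⟩
      have hlt : ∀ {i}, i ∈ Set.Icc 1 (2 * N) → i < 2 * N + 1 := fun hi =>
        Nat.lt_succ_of_le hi.2
      refine ⟨fun i => if hi : i < 2 * N + 1 then p ⟨i, hi⟩ else 0, ?_, ?_⟩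
      · intro i hi j hj hij
        simp only [hlt hi, hlt hj, dif_pos]
        exact hp _ _ hi.1 hij
      · intro i hi
        simp only [hlt hi, dif_pos]
        exact h ⟨i, hlt hi⟩ hi.1
  rw [this]
  refine MeasurableSet.iUnion fun p => ?_
  rw [Set.ofPred_and]
  refine (MeasurableSet.const _).inter ?_
  simp only [Set.ofPred_and, Set.ofPred_forall]
  refine (MeasurableSet.iInter fun i =>
    MeasurableSet.iInter fun _ => MeasurableSet.inter (MeasurableSet.const _)
      (MeasurableSet.inter (MeasurableSet.iInter fun _ => ?_) (MeasurableSet.iInter fun _ => ?_)))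
  · exact measurableSet_le (havg _) measurable_const
  · exact measurableSet_le measurable_const (havg _)

open scoped Classical in
/-- The bound along a single orbit: the elements of `K` that send `x` to a fluctuating point make up
an exponentially small fraction of `A * A * K`. -/
theorem card_filter_fluctSetBelow_mul_le {S T c l : ℝ} {r L N k : ℕ}
    (hne : ∀ m, (F m).Nonempty) (hF : IsGood l F)
    (hfS : ∀ x, |f x| ≤ S) (hTα : S + |α| ≤ T) (hTβ : S + |β| ≤ T) (hc : 0 ≤ c) (hc1 : c ≤ 1)
    (hl : 0 ≤ l) (hr : 0 < r) (hrl : (r : ℝ) * l ≤ 1) (hgap : T * (c + 8 * l + 8 / r) < β - α)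
    (hk : r * (k + 1) ≤ N) {A K : Finset G} (hA1 : 1 ∈ A) (hA : ∀ m < L, F m ⊆ A) (x : X) :
    ((K.filter fun g => g • x ∈ fluctSetBelow F f α β N L).card : ℝ) * (1 + c) ^ k
      ≤ 3 * (A * A * K).card := by
  set D := K.filter fun g => g • x ∈ fluctSetBelow F f α β N L with hD
  have hex : ∀ g, ∃ n : ℕ → ℕ, g ∈ D → StrictMonoOn n (Set.Icc 1 (2 * N)) ∧
      ∀ i ∈ Set.Icc 1 (2 * N), n i < L ∧ (Odd i → avg F f (n i) (g • x) ≤ α) ∧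
        (Even i → β ≤ avg F f (n i) (g • x)) := by
    intro g
    by_cases hg : g ∈ D
    · obtain ⟨n, hn⟩ := (Finset.mem_filter.1 hg).2
      exact ⟨n, fun _ => hn⟩
    · exact ⟨id, fun h => absurd h hg⟩
  choose n hn using hex
  have hDK : D ⊆ K := Finset.filter_subset _ _
  have hsub : ∀ B : Finset G, B ⊆ A * B := fun B b hb => Finset.mem_mul.2 ⟨1, hA1, b, hb, one_mul b⟩
  have hcard : ∀ m, (0 : ℝ) < (F m).card := fun m => by exact_mod_cast (hne m).card_pos
  obtain ⟨w, hw, hle⟩ := exists_nearPacking_block (D := D) (Y := A * K) (Ω := A * (A * K))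
    (φ := fun g => f (g • x)) (n := n) hne hF (hDK.trans (hsub K)) (hsub _)
    (fun a ha m hm h hh => Finset.mul_mem_mul (hA m hm hh) (hDK ha))
    (fun y hy m hm h hh => Finset.mul_mem_mul (hA m hm hh) hy)
    (fun a ha => (hn a ha).1) (fun a ha i hi => ((hn a ha).2 i hi).1)
    (fun g => hfS _)
    (fun a ha i hi hodd => by
      have := ((hn a ha).2 i hi).2.1 hodd
      rw [avg, div_le_iff₀ (hcard _)] at this
      simpa only [mul_smul] using this)
    (fun a ha i hi heven => by
      have := ((hn a ha).2 i hi).2.2 heven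
      rw [avg, le_div_iff₀ (hcard _)] at this
      simpa only [mul_smul] using this)
    hTα hTβ hc hc1 hl hr hrl hgap k hk
  rw [mul_assoc]
  linarith [hw.mass_le]

open scoped Classical in
/-- Calderón's transference: a bound for the density of visits to `E`, along the same finite set `K`
for all points, bounds the measure of `E`. -/
theorem measureReal_le_of_card_le {G X : Type*} [Group G] [MulAction G X] [MeasurableSpace X]
    {μ : Measure X} [IsProbabilityMeasure μ] [MeasurableConstSMul G X]
    [SMulInvariantMeasure G X μ] {E : Set X} (hE : MeasurableSet E) {K : Finset G}
    (hK : K.Nonempty) {C : ℝ}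
    (h : ∀ x, ((K.filter fun g => g • x ∈ E).card : ℝ) ≤ C * K.card) : μ.real E ≤ C := by
  have hcK : (0 : ℝ) < K.card := by exact_mod_cast hK.card_pos
  have hpre : ∀ g : G, MeasurableSet ((fun x => g • x) ⁻¹' E) := fun g =>
    measurable_const_smul g hE
  have h1 : ∑ g ∈ K, μ.real ((fun x => g • x) ⁻¹' E) = K.card * μ.real E := by
    rw [← nsmul_eq_mul, ← Finset.sum_const]
    refine Finset.sum_congr rfl fun g _ => ?_
    exact (measurePreserving_smul g μ).measureReal_preimage hE.nullMeasurableSet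
  have h2 : ∑ g ∈ K, μ.real ((fun x => g • x) ⁻¹' E)
      = ∫ x, ∑ g ∈ K, ((fun x => g • x) ⁻¹' E).indicator (fun _ => (1 : ℝ)) x ∂μ := by
    rw [integral_finsetSum]
    · refine Finset.sum_congr rfl fun g _ => ?_
      rw [integral_indicator_const _ (hpre g)]; simp
    · intro g _
      exact (integrable_const _).indicator (hpre g)
  have h3 : ∫ x, ∑ g ∈ K, ((fun x => g • x) ⁻¹' E).indicator (fun _ => (1 : ℝ)) x ∂μ
      ≤ ∫ _, C * K.card ∂μ := by
    refine integral_mono (integrable_finsetSum _ fun g _ =>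
      (integrable_const _).indicator (hpre g)) (integrable_const _) fun x => ?_
    refine le_trans (le_of_eq ?_) (h x)
    simp [Set.indicator_apply]
  rw [integral_const, probReal_univ, one_smul, ← h2, h1, mul_comm] at h3
  exact le_of_mul_le_mul_right h3 hcK

/-- The exponential bound for a bounded measurable function, with explicit constants. The Følner
property is used only to find a set `K` with `|A * A * K| ≤ 2 |K|`. -/
theorem measureReal_fluctSet_mul_le {G X : Type*} [Group G] [MulAction G X] [MeasurableSpace X]
    {μ : Measure X} [IsProbabilityMeasure μ] [MeasurableConstSMul G X]
    [SMulInvariantMeasure G X μ] {F : ℕ → Finset G} {f : X → ℝ} {α β S T c l : ℝ} {r N k : ℕ}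
    (hF : IsLeftFolner F) (hgood : IsGood l F) (hf : Measurable f)
    (hfS : ∀ x, |f x| ≤ S) (hTα : S + |α| ≤ T) (hTβ : S + |β| ≤ T) (hc : 0 ≤ c) (hc1 : c ≤ 1)
    (hl : 0 ≤ l) (hr : 0 < r) (hrl : (r : ℝ) * l ≤ 1) (hgap : T * (c + 8 * l + 8 / r) < β - α)
    (hk : r * (k + 1) ≤ N) :
    μ.real (fluctSet F f α β N) * (1 + c) ^ k ≤ 6 := by
  classical
  have hpos : 0 < (1 + c) ^ k := by positivity
  rw [← le_div_iff₀ hpos]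
  have hbelow : ∀ L, μ.real (fluctSetBelow F f α β N L) ≤ 6 / (1 + c) ^ k := by
    intro L
    let A : Finset G := insert 1 ((Finset.range L).biUnion F)
    obtain ⟨K, hK, hAK⟩ := hF.exists_card_mul_le (A * A)
    refine measureReal_le_of_card_le (measurableSet_fluctSetBelow hf N L) hK fun x => ?_
    rw [div_mul_eq_mul_div, le_div_iff₀ hpos]
    refine (card_filter_fluctSetBelow_mul_le hF.1 hgood hfS hTα hTβ hc hc1 hl hr hrl hgap hk
      (A := A) (Finset.mem_insert_self _ _) (fun m hm => ?_) x).trans ?_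
    · exact (Finset.subset_biUnion_of_mem F (Finset.mem_range.2 hm)).trans
        (Finset.subset_insert _ _)
    · have : ((A * A * K).card : ℝ) ≤ 2 * K.card := by exact_mod_cast hAK
      linarith
  rw [fluctSet_eq_iUnion, measureReal_def, (monotone_fluctSetBelow N).measure_iUnion]
  refine ENNReal.toReal_le_of_le_ofReal (by positivity) (iSup_le fun L => ?_)
  rw [ENNReal.le_ofReal_iff_toReal_le (by finiteness) (by positivity)]
  exact hbelow L

theorem fluctSet_ae_eq {G X : Type*} [Group G] [Countable G] [MulAction G X] [MeasurableSpace X]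
    {μ : Measure X} [MeasurableConstSMul G X] [SMulInvariantMeasure G X μ] {F : ℕ → Finset G}
    {f f' : X → ℝ} {α β : ℝ} (h : f =ᵐ[μ] f') (N : ℕ) :
    fluctSet F f α β N =ᵐ[μ] fluctSet F f' α β N := by
  have h1 : ∀ᵐ x ∂μ, ∀ g : G, f (g • x) = f' (g • x) :=
    ae_all_iff.2 fun g => (measurePreserving_smul g μ).quasiMeasurePreserving.ae h
  filter_upwards [h1] with x hx
  have : ∀ n, avg F f n x = avg F f' n x := fun n => by simp only [avg, hx]
  change (x ∈ fluctSet F f α β N) = (x ∈ fluctSet F f' α β N)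
  simp only [fluctSet, Set.mem_ofPred_eq, this]

theorem exists_measurable_bounded_ae_eq {X : Type*} [MeasurableSpace X] {μ : Measure X}
    {f : X → ℝ} {S : ℝ} (hS : 0 ≤ S) (hf : MemLp f ⊤ μ)
    (hfS : eLpNorm f ⊤ μ ≤ ENNReal.ofReal S) :
    ∃ f' : X → ℝ, Measurable f' ∧ (∀ x, |f' x| ≤ S) ∧ f =ᵐ[μ] f' := by
  obtain ⟨g, hg, hfg⟩ := hf.1.aemeasurable
  refine ⟨fun x => max (-S) (min (g x) S), by fun_prop, fun x => ?_, ?_⟩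
  · exact abs_le.2 ⟨le_max_left _ _, max_le (by linarith) (min_le_right _ _)⟩
  · rw [eLpNorm_exponent_top] at hfS
    filter_upwards [hfg, ae_le_eLpNormEssSup (f := f) (μ := μ)] with x hx hb
    have h1 : ‖f x‖ ≤ S := by
      have h2 := hb.trans hfS
      rw [← ofReal_norm] at h2
      exact (ENNReal.ofReal_le_ofReal_iff hS).1 h2
    have h2 := abs_le.1 (Real.norm_eq_abs _ ▸ h1)
    rw [← hx, min_eq_left h2.2, max_eq_right h2.1]
end
end
end FolnerFluct

theorem theorem3p3 (α β S : ℝ) (hαβ : α < β) (hS : 0 < S) :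
    ∃ l c₀ c₁ : ℝ, 0 < l ∧ l < 1 ∧ 0 < c₀ ∧ c₀ < 1 ∧ 0 < c₁ ∧
      ∀ (G : Type*) [Group G] [Countable G] (F : ℕ → Finset G),
        FolnerFluct.IsLeftFolner F → FolnerFluct.IsGood l F →
        ∀ (X : Type*) [MeasurableSpace X] (μ : MeasureTheory.Measure X)
          [MeasureTheory.IsProbabilityMeasure μ]
          [MulAction G X] [MeasurableConstSMul G X] [MeasureTheory.SMulInvariantMeasure G X μ]
          (f : X → ℝ), MeasureTheory.MemLp f ⊤ μ →
          MeasureTheory.eLpNorm f ⊤ μ ≤ ENNReal.ofReal S →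
          ∀ N : ℕ, μ.real (FolnerFluct.fluctSet F f α β N) ≤ c₁ * c₀ ^ N := by
  set T := S + |α| + |β| with hT
  have hα := abs_nonneg α
  have hβ := abs_nonneg β
  have hTpos : 0 < T := by linarith
  set η := (β - α) / T with hη
  have hη0 : 0 < η := div_pos (by linarith) hTpos
  have hη1 : η ≤ 1 := by
    rw [hη, div_le_one hTpos]
    linarith [le_abs_self β, neg_abs_le α]
  -- with `c = η / 4` and `l = 1 / (2 * r)`, the sum `c + 8 * l + 8 / r = η / 4 + 12 / r` must be
  -- less than `η`
  obtain ⟨r, hr⟩ := exists_nat_ge (32 / η)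
  have hr32 : 32 ≤ η * r := by rwa [div_le_iff₀' hη0] at hr
  have hrpos : (0 : ℝ) < r := by nlinarith
  have hr1 : (1 : ℝ) ≤ r := by nlinarith
  set c := η / 4 with hc
  have hc0 : 0 < c := by positivity
  -- `1 - x` plays the role of the `r`-th root of `1 / (1 + c)`, by Bernoulli's inequality
  set x := c / ((1 + c) * r) with hx
  have hx0 : 0 < x := by positivity
  have hx1 : x < 1 := by
    rw [hx, div_lt_one (by positivity)]
    nlinarith
  have hpow : 1 ≤ (1 + c) * (1 - x) ^ r := by
    have h1 : 1 + (r : ℝ) * (-x) ≤ (1 + -x) ^ r := one_add_mul_le_pow (by linarith) r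
    have h2 : (1 + c) * (1 + (r : ℝ) * (-x)) = 1 := by
      rw [hx]; field_simp; ring
    calc (1 : ℝ) = (1 + c) * (1 + (r : ℝ) * (-x)) := h2.symm
      _ ≤ (1 + c) * (1 + -x) ^ r := mul_le_mul_of_nonneg_left h1 (by linarith)
      _ = _ := by rw [← sub_eq_add_neg]
  have hc₀ : 0 < 1 - x := by linarith
  have hgap : T * (c + 8 * (1 / (2 * r)) + 8 / r) < β - α := by
    have h1 : 8 * (1 / (2 * (r : ℝ))) + 8 / r = 12 / r := by field_simp; norm_num
    have h2 : 12 / (r : ℝ) ≤ 12 / 32 * η := by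
      rw [div_le_iff₀ hrpos]; linarith
    have h3 : β - α = T * η := by rw [hη]; field_simp
    rw [add_assoc, h1, h3]
    exact mul_lt_mul_of_pos_left (by linarith) hTpos
  refine ⟨1 / (2 * r), 1 - x, 6 * (1 + c) / (1 - x) ^ r, by positivity, ?_, hc₀, by linarith,
    by positivity, ?_⟩
  · rw [div_lt_one (by positivity)]; linarith
  intro G _ _ F hF hgood X _ μ _ _ _ _ f hf hfS N
  obtain ⟨f', hf', hf'S, hff'⟩ :=
    FolnerFluct.exists_measurable_bounded_ae_eq hS.le hf hfS
  rw [MeasureTheory.measureReal_congr (FolnerFluct.fluctSet_ae_eq hff' N)]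
  have hrN : 0 < r := by exact_mod_cast hrpos
  -- each block uses up `r` fluctuations, and the first block yields no growth
  have key : μ.real (FolnerFluct.fluctSet F f' α β N) * (1 + c) ^ (N / r) ≤ 6 * (1 + c) := by
    rcases hq : N / r with _ | k
    · have := MeasureTheory.measureReal_le_one (μ := μ) (s := FolnerFluct.fluctSet F f' α β N)
      linarith
    · have hk : r * (k + 1) ≤ N := by rw [← hq]; exact Nat.mul_div_le N r
      have := FolnerFluct.measureReal_fluctSet_mul_le (μ := μ) hF hgood hf' hf'S
        (T := T) (by linarith) (by linarith) hc0.le (by linarith) (by positivity) hrN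
        (by field_simp; norm_num) hgap hk
      rw [pow_succ, ← mul_assoc]
      exact mul_le_mul_of_nonneg_right this (by linarith)
  have hN : N ≤ r * (N / r) + r := by
    have := Nat.div_add_mod N r
    have := Nat.mod_lt N hrN
    omega
  have h1 : (1 - x) ^ (r * (N / r)) * (1 - x) ^ r ≤ (1 - x) ^ N := by
    rw [← pow_add]
    exact pow_le_pow_of_le_one hc₀.le (by linarith) hN
  have h2 : 1 ≤ (1 + c) ^ (N / r) * (1 - x) ^ (r * (N / r)) := by
    rw [pow_mul, ← mul_pow]
    exact one_le_pow₀ hpow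
  rw [div_mul_eq_mul_div, le_div_iff₀ (by positivity)]
  have hm : 0 ≤ μ.real (FolnerFluct.fluctSet F f' α β N) := MeasureTheory.measureReal_nonneg
  have hp : 0 < (1 - x) ^ r := by positivity
  calc μ.real (FolnerFluct.fluctSet F f' α β N) * (1 - x) ^ r
      ≤ (μ.real (FolnerFluct.fluctSet F f' α β N) * (1 - x) ^ r)
        * ((1 + c) ^ (N / r) * (1 - x) ^ (r * (N / r))) :=
        le_mul_of_one_le_right (by positivity) h2
    _ = (μ.real (FolnerFluct.fluctSet F f' α β N) * (1 + c) ^ (N / r))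
        * ((1 - x) ^ (r * (N / r)) * (1 - x) ^ r) := by ring
    _ ≤ 6 * (1 + c) * (1 - x) ^ N := by gcongr
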